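/- Identify $\mathbb{R}^2$ with $\mathbb{C}$, let $N\ge 1$ be an integer, let $w\in\mathbb{C}$ be a primitive $N$-th root of unity, and let $f\in\mathcal{D}(\mathbb{R}^2)'$ be a complex-valued Schwartz distribution. For $a\in\mathbb{C}$ let $f(z+ah)\in\mathcal{D}(\mathbb{R}^2\times\mathbb{R}^2)'$ be the distribution $$f(z+ah)\{\Phi\}=f\Big\{x\mapsto\int_{\mathbb{R}^2}\Phi(x-ay,\,y)\,dy\Big\},\qquad \Phi\in\mathcal{D}(\mathbb{R}^2\times\mathbb{R}^2),$$ and let $f(z)\cdot 1(h)$ be the tensor product of $f$ with the constant function $1$ (the case $a=0$). Suppose that $f$ satisfies the Kakutani--Nagumo--Walsh equation $$\frac1N\sum_{k=0}^{N-1}f(z+w^kh)=f(z)\cdot 1(h)\quad\text{in }\mathcal{D}(\mathbb{R}^2\times\mathbb{R}^2)',$$ or that it satisfies the homogeneous equation $\frac1N\sum_{k=0}^{N-1}f(z+w^kh)=0$ in $\mathcal{D}(\mathbb{R}^2\times\mathbb{R}^2)'$. Then $f$ is equal, in the distributional sense, to a harmonic polynomial of degree at most $N$: there is a harmonic function $u:\mathbb{R}^2\to\mathbb{C}$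 that is a polynomial in the two real coordinates, with complex coefficients and total degree at most $N$, such that $f\{\varphi\}=\int_{\mathbb{R}^2}\varphi\,u$ for every test function $\varphi$. -/

import Mathlib

open MeasureTheory TopologicalSpace
open scoped Distributions ContDiff

namespace KNW

section FiberIntegral

set_option linter.unusedSectionVars false

variable {F : Type} [NormedAddCommGroup F] [NormedSpace ℝ F]

/-- For a function `Ψ` on `ℂ × ℂ`, the function `x ↦ ∫ Ψ(x - a y, y) dy` on `ℂ`
(`dy` is Lebesgue measure on `ℂ = ℝ²`). -/
noncomputable def fiberIntegralFun (a : ℂ) (Ψ : ℂ × ℂ → F) (x : ℂ) : F :=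
  ∫ y : ℂ, Ψ (x - a * y, y)

lemma fiber_norm_le_indicator {Ψ : ℂ × ℂ → F} {K : Set (ℂ × ℂ)} {C : ℝ}
    (hK : ∀ p, p ∉ K → Ψ p = 0) (hC : ∀ p, ‖Ψ p‖ ≤ C) (a x y : ℂ) :
    ‖Ψ (x - a * y, y)‖ ≤ (Prod.snd '' K).indicator (fun _ => C) y := by
  by_cases hy : y ∈ Prod.snd '' K
  · rw [Set.indicator_of_mem hy]
    exact hC _
  · rw [Set.indicator_of_notMem hy, hK _ (fun h => hy ⟨_, h, rfl⟩), norm_zero]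

lemma fiber_integrable_bound {K : Set (ℂ × ℂ)} (hKc : IsCompact K) (C : ℝ) :
    Integrable ((Prod.snd '' K).indicator (fun _ => C)) (volume : Measure ℂ) := by
  have hc : IsCompact (Prod.snd '' K) := hKc.image continuous_snd
  exact (integrable_indicator_iff hc.measurableSet).2
    (integrableOn_const hc.measure_lt_top.ne)

lemma exists_bound_of_support {Ψ : ℂ × ℂ → F} {K : Set (ℂ × ℂ)} (hKc : IsCompact K)
    (hΨ : Continuous Ψ) (hK : ∀ p, p ∉ K → Ψ p = 0) : ∃ C, ∀ p, ‖Ψ p‖ ≤ C :=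
  hΨ.bounded_above_of_compact_support (HasCompactSupport.intro hKc (fun p hp => hK p hp))

lemma fiber_integrable {Ψ : ℂ × ℂ → F} {K : Set (ℂ × ℂ)} (hKc : IsCompact K)
    (hΨ : Continuous Ψ) (hK : ∀ p, p ∉ K → Ψ p = 0) (a x : ℂ) :
    Integrable (fun y : ℂ => Ψ (x - a * y, y)) := by
  obtain ⟨C, hC⟩ := exists_bound_of_support hKc hΨ hK
  refine (fiber_integrable_bound hKc C).mono' ?_ (ae_of_all _ fun y => ?_)
  · exact (hΨ.comp (by fun_prop)).aestronglyMeasurable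
  · exact fiber_norm_le_indicator hK hC a x y

/-- The partial derivative in the first variable. -/
noncomputable def fderivFst (Ψ : ℂ × ℂ → F) (p : ℂ × ℂ) : ℂ →L[ℝ] F :=
  (fderiv ℝ Ψ p).comp (ContinuousLinearMap.inl ℝ ℂ ℂ)

lemma fderivFst_eq_zero {Ψ : ℂ × ℂ → F} {K : Set (ℂ × ℂ)} (hKc : IsCompact K)
    (hK : ∀ p, p ∉ K → Ψ p = 0) (p : ℂ × ℂ) (hp : p ∉ K) : fderivFst Ψ p = 0 := by
  have h : Ψ =ᶠ[nhds p] fun _ => 0 := by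
    filter_upwards [hKc.isClosed.isOpen_compl.mem_nhds hp] with q hq using hK q hq
  rw [fderivFst, h.fderiv_eq]
  simp

lemma fderivFst_eq_comp (Ψ : ℂ × ℂ → F) :
    fderivFst Ψ = ((ContinuousLinearMap.compL ℝ ℂ (ℂ × ℂ) F).flip
      (ContinuousLinearMap.inl ℝ ℂ ℂ)) ∘ fderiv ℝ Ψ := rfl

lemma contDiff_fderivFst {Ψ : ℂ × ℂ → F} (hΨ : ContDiff ℝ ∞ Ψ) :
    ContDiff ℝ ∞ (fderivFst Ψ) := by
  rw [fderivFst_eq_comp]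
  exact (ContinuousLinearMap.contDiff _).comp (hΨ.fderiv_right (by simp))

lemma norm_iteratedFDeriv_fderivFst_le {Ψ : ℂ × ℂ → F} (hΨ : ContDiff ℝ ∞ Ψ) (n : ℕ)
    (p : ℂ × ℂ) : ‖iteratedFDeriv ℝ n (fderivFst Ψ) p‖ ≤ ‖iteratedFDeriv ℝ (n + 1) Ψ p‖ := by
  have hT : ‖(ContinuousLinearMap.compL ℝ ℂ (ℂ × ℂ) F).flip
      (ContinuousLinearMap.inl ℝ ℂ ℂ)‖ ≤ 1 := by
    refine ContinuousLinearMap.opNorm_le_bound _ zero_le_one fun g => ?_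
    have h1 : ‖g.comp (ContinuousLinearMap.inl ℝ ℂ ℂ)‖ ≤
        ‖g‖ * ‖ContinuousLinearMap.inl ℝ ℂ ℂ‖ := g.opNorm_comp_le _
    have h2 : ‖ContinuousLinearMap.inl ℝ ℂ ℂ‖ ≤ 1 :=
      ContinuousLinearMap.norm_inl_le_one ℝ ℂ ℂ
    have h3 := mul_le_mul_of_nonneg_left h2 (norm_nonneg g)
    simp only [ContinuousLinearMap.flip_apply, ContinuousLinearMap.compL_apply]
    linarith
  have hd : ContDiff ℝ ∞ (fderiv ℝ Ψ) := hΨ.fderiv_right (by simp)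
  rw [fderivFst_eq_comp, ContinuousLinearMap.iteratedFDeriv_comp_left _
    (hd.contDiffAt) (by exact_mod_cast le_top), ← norm_iteratedFDeriv_fderiv]
  refine (ContinuousLinearMap.norm_compContinuousMultilinearMap_le _ _).trans ?_
  exact mul_le_of_le_one_left (norm_nonneg _) hT

lemma hasFDerivAt_fiberIntegralFun {Ψ : ℂ × ℂ → F} {K : Set (ℂ × ℂ)} (hKc : IsCompact K)
    (hΨ : ContDiff ℝ ∞ Ψ) (hK : ∀ p, p ∉ K → Ψ p = 0) (a x : ℂ) :
    HasFDerivAt (fiberIntegralFun a Ψ) (fiberIntegralFun a (fderivFst Ψ) x) x := by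
  have hd := contDiff_fderivFst hΨ
  have hK' := fderivFst_eq_zero hKc hK
  obtain ⟨C, hC⟩ := exists_bound_of_support hKc hd.continuous hK'
  refine hasFDerivAt_integral_of_dominated_of_fderiv_le
    (F := fun x y => Ψ (x - a * y, y)) (F' := fun x y => fderivFst Ψ (x - a * y, y))
    (bound := (Prod.snd '' K).indicator (fun _ => C)) (Filter.univ_mem) ?_ ?_ ?_ ?_ ?_ ?_
  · exact Filter.Eventually.of_forall fun z =>
      (fiber_integrable hKc hΨ.continuous hK a z).aestronglyMeasurable
  · exact fiber_integrable hKc hΨ.continuous hK a x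
  · exact (fiber_integrable hKc hd.continuous hK' a x).aestronglyMeasurable
  · exact ae_of_all _ fun y z _ => fiber_norm_le_indicator hK' hC a z y
  · exact fiber_integrable_bound hKc C
  · refine ae_of_all _ fun y z _ => ?_
    have h1 : HasFDerivAt Ψ (fderiv ℝ Ψ (z - a * y, y)) (z - a * y, y) :=
      ((hΨ.differentiable (by simp)) _).hasFDerivAt
    have h2 : HasFDerivAt (fun z : ℂ => (z - a * y, y)) (ContinuousLinearMap.inl ℝ ℂ ℂ) z :=
      ((hasFDerivAt_id z).sub_const (a * y)).prodMk (hasFDerivAt_const y z)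
    exact h1.comp z h2

lemma contDiff_fiberIntegralFun_nat (a : ℂ) {K : Set (ℂ × ℂ)} (hKc : IsCompact K) (n : ℕ) :
    ∀ {F : Type} [NormedAddCommGroup F] [NormedSpace ℝ F] {Ψ : ℂ × ℂ → F},
      ContDiff ℝ ∞ Ψ → (∀ p, p ∉ K → Ψ p = 0) → ContDiff ℝ n (fiberIntegralFun a Ψ) := by
  induction n with
  | zero =>
    intro F _ _ Ψ hΨ hK
    have h : Differentiable ℝ (fiberIntegralFun a Ψ) := fun x =>
      (hasFDerivAt_fiberIntegralFun hKc hΨ hK a x).differentiableAt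
    exact contDiff_zero.2 h.continuous
  | succ n ih =>
    intro F _ _ Ψ hΨ hK
    have h := hasFDerivAt_fiberIntegralFun hKc hΨ hK a
    push_cast
    refine contDiff_succ_iff_hasFDerivAt.2 ⟨_, ?_, h⟩
    exact ih (contDiff_fderivFst hΨ) (fderivFst_eq_zero hKc hK)

lemma contDiff_fiberIntegralFun (a : ℂ) {K : Set (ℂ × ℂ)} (hKc : IsCompact K)
    {Ψ : ℂ × ℂ → F} (hΨ : ContDiff ℝ ∞ Ψ) (hK : ∀ p, p ∉ K → Ψ p = 0) :
    ContDiff ℝ ∞ (fiberIntegralFun a Ψ) :=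
  contDiff_infty.2 fun n => contDiff_fiberIntegralFun_nat a hKc n hΨ hK

lemma norm_iteratedFDeriv_fiberIntegralFun_le (a : ℂ) {K : Set (ℂ × ℂ)} (hKc : IsCompact K)
    (n : ℕ) : ∀ {F : Type} [NormedAddCommGroup F] [NormedSpace ℝ F] {Ψ : ℂ × ℂ → F},
      ContDiff ℝ ∞ Ψ → (∀ p, p ∉ K → Ψ p = 0) → ∀ C : ℝ,
      (∀ p, ‖iteratedFDeriv ℝ n Ψ p‖ ≤ C) → ∀ x,
      ‖iteratedFDeriv ℝ n (fiberIntegralFun a Ψ) x‖ ≤ volume.real (Prod.snd '' K) * C := by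
  induction n with
  | zero =>
    intro F _ _ Ψ hΨ hK C hC x
    simp only [norm_iteratedFDeriv_zero] at hC ⊢
    have hc : IsCompact (Prod.snd '' K) := hKc.image continuous_snd
    calc ‖fiberIntegralFun a Ψ x‖
        ≤ ∫ y, (Prod.snd '' K).indicator (fun _ => C) y :=
          norm_integral_le_of_norm_le (fiber_integrable_bound hKc C)
            (ae_of_all _ fun y => fiber_norm_le_indicator hK hC a x y)
      _ = volume.real (Prod.snd '' K) * C := by
          rw [integral_indicator hc.measurableSet]
          simp
  | succ n ih =>
    intro F _ _ Ψ hΨ hK C hC x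
    have h : fderiv ℝ (fiberIntegralFun a Ψ) = fiberIntegralFun a (fderivFst Ψ) :=
      funext fun x => (hasFDerivAt_fiberIntegralFun hKc hΨ hK a x).fderiv
    rw [← norm_iteratedFDeriv_fderiv, h]
    exact ih (contDiff_fderivFst hΨ) (fderivFst_eq_zero hKc hK) C
      (fun p => (norm_iteratedFDeriv_fderivFst_le hΨ n p).trans (hC p)) x

lemma fiberIntegralFun_eq_zero (a : ℂ) {K : Set (ℂ × ℂ)} {Ψ : ℂ × ℂ → F}
    (hK : ∀ p, p ∉ K → Ψ p = 0) {x : ℂ} (hx : x ∉ (fun p : ℂ × ℂ => p.1 + a * p.2) '' K) :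
    fiberIntegralFun a Ψ x = 0 := by
  have h : ∀ y : ℂ, Ψ (x - a * y, y) = 0 := fun y =>
    hK _ fun hy => hx ⟨_, hy, by simp⟩
  simp [fiberIntegralFun, h]

end FiberIntegral

/-- The image of a compact set under `(z, h) ↦ z + a h`. -/
noncomputable def sumCompacts (a : ℂ) (K : Compacts (ℂ × ℂ)) : Compacts ℂ :=
  K.map (fun p => p.1 + a * p.2) (by fun_prop)

/-- The fibre integral as a test function. -/
noncomputable def fiberIntegralTest (a : ℂ) (Φ : 𝓓((⊤ : Opens (ℂ × ℂ)), ℝ)) :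
    𝓓((⊤ : Opens ℂ), ℝ) where
  toFun := fiberIntegralFun a Φ
  contDiff' := contDiff_fiberIntegralFun a Φ.hasCompactSupport Φ.contDiff
    fun _ hp => image_eq_zero_of_notMem_tsupport hp
  hasCompactSupport' := HasCompactSupport.intro
    (Φ.hasCompactSupport.isCompact.image (f := fun p : ℂ × ℂ => p.1 + a * p.2) (by fun_prop))
    fun _ hx => fiberIntegralFun_eq_zero a (fun _ hp => image_eq_zero_of_notMem_tsupport hp) hx
  tsupport_subset' := fun _ _ => trivial

/-- The fibre integral on test functions supported in a fixed compact set, as a linear map. -/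
noncomputable def fiberIntegralSupportedInLM (a : ℂ) (K : Compacts (ℂ × ℂ)) :
    ContDiffMapSupportedIn (ℂ × ℂ) ℝ ⊤ K →ₗ[ℝ]
      ContDiffMapSupportedIn ℂ ℝ ⊤ (sumCompacts a K) where
  toFun Φ := ⟨fiberIntegralFun a Φ,
    contDiff_fiberIntegralFun a K.isCompact Φ.contDiff (fun _ hp => Φ.zero_on_compl hp),
    fun _ hx => fiberIntegralFun_eq_zero a (fun _ hp => Φ.zero_on_compl hp) hx⟩
  map_add' Φ Ψ := ContDiffMapSupportedIn.ext fun x => integral_add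
    (fiber_integrable K.isCompact Φ.continuous (fun _ hp => Φ.zero_on_compl hp) a x)
    (fiber_integrable K.isCompact Ψ.continuous (fun _ hp => Ψ.zero_on_compl hp) a x)
  map_smul' c Φ := ContDiffMapSupportedIn.ext fun x =>
    integral_const_mul c (fun y : ℂ => Φ (x - a * y, y))

/-- The fibre integral on test functions supported in a fixed compact set, as a continuous
linear map. -/
noncomputable def fiberIntegralSupportedIn (a : ℂ) (K : Compacts (ℂ × ℂ)) :
    ContDiffMapSupportedIn (ℂ × ℂ) ℝ ⊤ K →L[ℝ]
      ContDiffMapSupportedIn ℂ ℝ ⊤ (sumCompacts a K) where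
  toLinearMap := fiberIntegralSupportedInLM a K
  cont := show Continuous (fiberIntegralSupportedInLM a K) by
    refine WithSeminorms.continuous_of_isBounded (ContDiffMapSupportedIn.withSeminorms ℝ ..)
      (ContDiffMapSupportedIn.withSeminorms ℝ ..) _ (.of_real fun i => ⟨{i},
        volume.real (Prod.snd '' (K : Set (ℂ × ℂ))), fun Φ => ?_⟩)
    rw [Finset.sup_singleton]
    refine (ContDiffMapSupportedIn.seminorm_top_le_iff ℝ
      (mul_nonneg measureReal_nonneg (apply_nonneg _ _)) i _).2 fun x _ => ?_
    exact norm_iteratedFDeriv_fiberIntegralFun_le a K.isCompact i Φ.contDiff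
      (fun _ hp => Φ.zero_on_compl hp) _
      (fun p => ContDiffMapSupportedIn.norm_iteratedFDeriv_apply_le_seminorm_top ℝ) x

/-- The continuous linear map `𝓓(ℝ² × ℝ²) → 𝓓(ℝ²)`,
`Φ ↦ (x ↦ ∫ Φ(x - a y, y) dy)`. -/
noncomputable def fiberIntegral (a : ℂ) :
    𝓓((⊤ : Opens (ℂ × ℂ)), ℝ) →L[ℝ] 𝓓((⊤ : Opens ℂ), ℝ) :=
  TestFunction.limitCLM ℝ (fiberIntegralTest a)
    (fun K _ => TestFunction.ofSupportedInCLM ℝ (Set.subset_univ _) ∘L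
      fiberIntegralSupportedIn a K)
    (fun _ _ _ => rfl)

lemma fiberIntegral_apply (a : ℂ) (Φ : 𝓓((⊤ : Opens (ℂ × ℂ)), ℝ)) (x : ℂ) :
    fiberIntegral a Φ x = ∫ y : ℂ, Φ (x - a * y, y) := rfl

/-- The distribution `f(z + a h)` in the variables `(z, h)` of `ℝ² × ℝ² = ℂ × ℂ`, for a
distribution `f` on `ℝ² = ℂ` and a complex number `a`. It is given by
`f(z + a h){Φ} = f{x ↦ ∫ Φ(x - a y, y) dy}`: for a locally integrable function `f` this is
`∫∫ f(z + a h) Φ(z, h) dz dh` after the substitution `x = z + a h`, and for a product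
`Φ(z, h) = φ₁(z) φ₂(h)` and `a ≠ 0` it is `f{|det c|⁻¹ φ₁ ∗ (φ₂ ∘ c⁻¹)}`, where `c` is the
multiplication by `a`. -/
noncomputable def shiftDistribution (f : 𝓓'((⊤ : Opens ℂ), ℂ)) (a : ℂ) :
    𝓓'((⊤ : Opens (ℂ × ℂ)), ℂ) :=
  (fiberIntegral a).precompCompactConvergenceCLM ℂ f

lemma shiftDistribution_apply (f : 𝓓'((⊤ : Opens ℂ), ℂ)) (a : ℂ)
    (Φ : 𝓓((⊤ : Opens (ℂ × ℂ)), ℝ)) :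
    shiftDistribution f a Φ = f (fiberIntegral a Φ) := rfl

/-- The tensor product `f(z) · 1(h)`, given by `(f(z) · 1(h)){Φ} = f{x ↦ ∫ Φ(x, y) dy}`. -/
noncomputable def tensorOne (f : 𝓓'((⊤ : Opens ℂ), ℂ)) : 𝓓'((⊤ : Opens (ℂ × ℂ)), ℂ) :=
  shiftDistribution f 0

lemma tensorOne_apply (f : 𝓓'((⊤ : Opens ℂ), ℂ)) (Φ : 𝓓((⊤ : Opens (ℂ × ℂ)), ℝ))
    (φ : 𝓓((⊤ : Opens ℂ), ℝ)) (hφ : ∀ x, φ x = ∫ y : ℂ, Φ (x, y)) :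
    tensorOne f Φ = f φ := by
  have h : fiberIntegral 0 Φ = φ := by
    ext x
    rw [fiberIntegral_apply, hφ]
    simp
  rw [tensorOne, shiftDistribution_apply, h]

/-- The distribution `(1/N) ∑_{k=0}^{N-1} f(z + w^k h)` on `ℝ² × ℝ²`. -/
noncomputable def vertexMean (N : ℕ) (w : ℂ) (f : 𝓓'((⊤ : Opens ℂ), ℂ)) :
    𝓓'((⊤ : Opens (ℂ × ℂ)), ℂ) :=
  (1 / (N : ℝ)) • ∑ k ∈ Finset.range N, shiftDistribution f (w ^ k)

/-- The distribution `f` is equal to the continuous function `u`. -/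
def EqFunction (f : 𝓓'((⊤ : Opens ℂ), ℂ)) (u : ℂ → ℂ) : Prop :=
  Continuous u ∧ ∀ φ : 𝓓((⊤ : Opens ℂ), ℝ), f φ = ∫ z : ℂ, (φ z : ℂ) * u z

/-- `u` is a (complex valued) harmonic polynomial of degree at most `N` on `ℝ² = ℂ`: a
polynomial in the real coordinates, of total degree at most `N`, that is harmonic. -/
def IsHarmonicPolynomial (N : ℕ) (u : ℂ → ℂ) : Prop :=
  (∃ p : MvPolynomial (Fin 2) ℂ, p.totalDegree ≤ N ∧
    ∀ z : ℂ, u z = MvPolynomial.eval ![(z.re : ℂ), (z.im : ℂ)] p) ∧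
  InnerProductSpace.HarmonicOnNhd u Set.univ

end KNW

/-! Test the equation on `φ(x) ρ(y)` with `ρ` radial of integral one. Each `w ^ k` has modulus one,
so rotation invariance makes every summand on the left equal to `f(φ ∗ ρ)`, while the right side is
`f(φ)`. As `f` commutes with the convolution integral (`apply_fiberIntegral_tensor`), `f` is the
continuous function `u(v) = f(ρ(· - v))`. Then `u` is its own convolution with `ρ`, hence smooth.

Testing on `φ(x) ψ(y)` with `ψ` arbitrary gives a pointwise identity (`sum_apply_translate`); for `φ
= ρ(· - z)` it reads `∑ u(z + w^k h) = N u(z)`. Two consequences follow. Differentiating in `(z, h)`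
along a direction that fixes one of the points `z + w^k h` removes that summand, so after `N` such
derivatives nothing is left and `u` is a polynomial of degree at most `N`
(`exists_mvPolynomial_of_sum_eq`). The second derivative in `h` at `h = 0`, summed over two
orthogonal directions, gives `N Δu = 0` (`harmonicOnNhd_of_sum_eq`).

For the homogeneous equation the pointwise identity at `h = 0` says `N f(φ) = 0`, so `f = 0`. -/

namespace KNW

/-! ### Polynomiality from a functional equation -/

section Polynomial

open MvPolynomial

lemma eval_smul_of_isHomogeneous {σ R : Type*} [CommSemiring R] {p : MvPolynomial σ R} {n : ℕ}
    (hp : p.IsHomogeneous n) (t : R) (v : σ → R) :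
    eval (t • v) p = t ^ n * eval v p := by
  rw [eval_eq, eval_eq, Finset.mul_sum]
  refine Finset.sum_congr rfl fun d hd => ?_
  have h : d.degree = n := by
    rw [Finsupp.degree_eq_weight_one]
    exact hp (mem_support_iff.1 hd)
  simp only [Pi.smul_apply, smul_eq_mul, mul_pow, Finset.prod_mul_distrib,
    Finset.prod_pow_eq_pow_sum]
  rw [← h, Finsupp.degree_apply, mul_left_comm]

lemma sum_homogeneousComponent_of_totalDegree_le {σ R : Type*} [CommSemiring R]
    {p : MvPolynomial σ R} {m : ℕ} (hp : p.totalDegree ≤ m) :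
    ∑ n ∈ Finset.range (m + 1), homogeneousComponent n p = p := by
  conv_rhs => rw [← sum_homogeneousComponent p]
  refine (Finset.sum_subset (Finset.range_mono (by omega)) fun n _ hn => ?_).symm
  exact homogeneousComponent_eq_zero _ _ (by simpa using hn)

/-- A function on the plane whose partial derivatives are polynomials of degree at most `m` is a
polynomial of degree at most `m + 1`. -/
lemma exists_mvPolynomial_of_fderiv {m : ℕ} {G : ℂ → ℂ} (hG : Differentiable ℝ G)
    {p q : MvPolynomial (Fin 2) ℂ} (hp : p.totalDegree ≤ m) (hq : q.totalDegree ≤ m)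
    (h₁ : ∀ z : ℂ, fderiv ℝ G z 1 = eval ![(z.re : ℂ), (z.im : ℂ)] p)
    (h₂ : ∀ z : ℂ, fderiv ℝ G z Complex.I = eval ![(z.re : ℂ), (z.im : ℂ)] q) :
    ∃ P : MvPolynomial (Fin 2) ℂ, P.totalDegree ≤ m + 1 ∧
      ∀ z : ℂ, G z = eval ![(z.re : ℂ), (z.im : ℂ)] P := by
  -- This is `G(0) + ∫₀¹ DG(tz) z dt`: the degree `n` components of the partial derivatives scale by
  -- `t ^ n`, whence the factor `1 / (n + 1)`.
  refine ⟨C (G 0) + ∑ n ∈ Finset.range (m + 1), C (1 / ((n : ℂ) + 1)) *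
    (X 0 * homogeneousComponent n p + X 1 * homogeneousComponent n q), ?_, fun z => ?_⟩
  · refine (totalDegree_add _ _).trans (max_le (by simp) ?_)
    refine (totalDegree_finsetSum _ _).trans (Finset.sup_le fun n hn => ?_)
    have hn' : n ≤ m := by simpa [Nat.lt_succ_iff] using hn
    have hX : ∀ (i : Fin 2) (r : MvPolynomial (Fin 2) ℂ),
        (X i * homogeneousComponent n r).totalDegree ≤ m + 1 := fun i r => by
      refine (totalDegree_mul _ _).trans ?_
      have := (homogeneousComponent_isHomogeneous n r).totalDegree_le
      rw [totalDegree_X]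
      omega
    refine (totalDegree_mul _ _).trans ?_
    rw [totalDegree_C, zero_add]
    exact (totalDegree_add _ _).trans (max_le (hX _ _) (hX _ _))
  · set v : Fin 2 → ℂ := ![(z.re : ℂ), (z.im : ℂ)] with hv
    set a : ℕ → ℂ := fun n => z.re * eval v (homogeneousComponent n p) +
      z.im * eval v (homogeneousComponent n q) with ha
    have hvt : ∀ t : ℝ, ![((t • z).re : ℂ), ((t • z).im : ℂ)] = (t : ℂ) • v := fun t => by
      ext i; fin_cases i <;> simp [hv]
    have hexp : ∀ (t : ℝ) (r : MvPolynomial (Fin 2) ℂ), r.totalDegree ≤ m →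
        eval ((t : ℂ) • v) r =
          ∑ n ∈ Finset.range (m + 1), (t : ℂ) ^ n * eval v (homogeneousComponent n r) := by
      intro t r hr
      conv_lhs => rw [← sum_homogeneousComponent_of_totalDegree_le hr]
      rw [map_sum]
      exact Finset.sum_congr rfl fun n _ =>
        eval_smul_of_isHomogeneous (homogeneousComponent_isHomogeneous n r) _ _
    have hd : ∀ t : ℝ, HasDerivAt (fun t : ℝ => G (t • z) -
        ∑ n ∈ Finset.range (m + 1), 1 / ((n : ℂ) + 1) * ((t : ℂ) ^ (n + 1) * a n)) 0 t := by
      intro t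
      have e₁ : HasDerivAt (fun t : ℝ => G (t • z)) (fderiv ℝ G (t • z) z) t := by
        have := (hG (t • z)).hasFDerivAt.comp_hasDerivAt t ((hasDerivAt_id t).smul_const z)
        simpa using! this
      have e₂ : HasDerivAt (fun t : ℝ => ∑ n ∈ Finset.range (m + 1),
          1 / ((n : ℂ) + 1) * ((t : ℂ) ^ (n + 1) * a n))
          (∑ n ∈ Finset.range (m + 1), (t : ℂ) ^ n * a n) t := by
        refine HasDerivAt.fun_sum fun n _ => ?_
        have h0 : HasDerivAt (fun t : ℝ => (t : ℂ)) 1 t := Complex.ofRealCLM.hasDerivAt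
        have h1 := ((h0.fun_pow (n + 1)).mul_const (a n)).const_mul (1 / ((n : ℂ) + 1))
        refine h1.congr_deriv ?_
        have : (n : ℂ) + 1 ≠ 0 := by exact_mod_cast Nat.succ_ne_zero n
        push_cast
        field_simp
      refine (e₁.sub e₂).congr_deriv (sub_eq_zero.2 ?_)
      have hz : z = z.re • (1 : ℂ) + z.im • Complex.I := by
        apply Complex.ext <;> simp
      have hfz : fderiv ℝ G (t • z) z = z.re • fderiv ℝ G (t • z) 1 +
          z.im • fderiv ℝ G (t • z) Complex.I := by
        rw [← map_smul, ← map_smul, ← map_add, ← hz]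
      rw [hfz, h₁, h₂, hvt, hexp t p hp, hexp t q hq,
        Complex.real_smul, Complex.real_smul, Finset.mul_sum, Finset.mul_sum,
        ← Finset.sum_add_distrib]
      refine Finset.sum_congr rfl fun n _ => ?_
      simp only [ha]
      ring
    have hc := is_const_of_deriv_eq_zero (fun t => (hd t).differentiableAt)
      (fun t => (hd t).deriv) 1 0
    simp only [one_smul, zero_smul, Complex.ofReal_one, one_pow, one_mul, Complex.ofReal_zero,
      ne_eq, Nat.add_eq_zero_iff, one_ne_zero, and_false, not_false_eq_true, zero_pow, zero_mul,
      mul_zero, Finset.sum_const_zero, sub_zero] at hc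
    rw [sub_eq_iff_eq_add.1 hc]
    simp [ha, hv]

end Polynomial

/-- If `∑ g_k(z + c_k h)` does not depend on `h` and no `c_k` vanishes, then it is a polynomial in
`z`, of degree at most the number of summands. -/
lemma exists_mvPolynomial_of_sum_eq {ι : Type*} [DecidableEq ι] (s : Finset ι) (c : ι → ℂ) :
    (∀ k ∈ s, c k ≠ 0) → ∀ (G : ℂ → ℂ) (g : ι → ℂ → ℂ), ContDiff ℝ ∞ G →
      (∀ k, ContDiff ℝ ∞ (g k)) → (∀ z h, ∑ k ∈ s, g k (z + c k * h) = G z) →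
      ∃ P : MvPolynomial (Fin 2) ℂ, P.totalDegree ≤ s.card ∧
        ∀ z : ℂ, G z = MvPolynomial.eval ![(z.re : ℂ), (z.im : ℂ)] P := by
  induction s using Finset.induction_on with
  | empty =>
    intro _ G g _ _ h
    exact ⟨0, by simp, fun z => by simpa using (h z 0).symm⟩
  | insert j s hj ih =>
    intro hc G g hG hg h
    have hdiff : ∀ {f : ℂ → ℂ}, ContDiff ℝ ∞ f → ∀ v : ℂ,
        ContDiff ℝ ∞ fun z => fderiv ℝ f z v := fun hf v =>
      (hf.fderiv_right (by simp)).clm_apply contDiff_const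
    have key : ∀ v : ℂ, ∃ P : MvPolynomial (Fin 2) ℂ, P.totalDegree ≤ s.card ∧
        ∀ z : ℂ, fderiv ℝ G z v = MvPolynomial.eval ![(z.re : ℂ), (z.im : ℂ)] P := by
      intro v
      have hj0 := hc j (Finset.mem_insert_self j s)
      -- Move `z` with velocity `v` and `h` with velocity `-v / c j`. The point `z + c k * h` then
      -- has velocity `v - c k * (v / c j)`, which vanishes for `k = j`, so one summand drops out
      -- and `G` is replaced by its derivative along `v`.
      refine ih (fun k hk => hc k (Finset.mem_insert_of_mem hk)) (fun z => fderiv ℝ G z v)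
        (fun k z => fderiv ℝ (g k) z (v - c k * (v / c j))) (hdiff hG v)
        (fun k => hdiff (hg k) _) fun z h' => ?_
      have hline : ∀ {f : ℂ → ℂ}, ContDiff ℝ ∞ f → ∀ z v : ℂ,
          HasDerivAt (fun t : ℝ => f (z + t • v)) (fderiv ℝ f z v) 0 := by
        intro f hf z v
        have h1 : HasDerivAt (fun t : ℝ => z + t • v) v 0 := by
          simpa using! ((hasDerivAt_id (0 : ℝ)).smul_const v).const_add z
        have h2 : HasFDerivAt f (fderiv ℝ f z) (z + (0 : ℝ) • v) := by
          simpa using (hf.differentiable (by simp) z).hasFDerivAt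
        exact h2.comp_hasDerivAt 0 h1
      have e₁ : HasDerivAt (fun t : ℝ => ∑ k ∈ insert j s,
          g k (z + c k * h' + t • (v - c k * (v / c j))))
          (∑ k ∈ insert j s, fderiv ℝ (g k) (z + c k * h') (v - c k * (v / c j))) 0 :=
        HasDerivAt.fun_sum fun k _ => hline (hg k) _ _
      have e₂ := hline hG z v
      have heq : (fun t : ℝ => ∑ k ∈ insert j s,
          g k (z + c k * h' + t • (v - c k * (v / c j)))) = fun t : ℝ => G (z + t • v) := by
        funext t
        rw [← h (z + t • v) (h' - t * (v / c j))]
        refine Finset.sum_congr rfl fun k _ => ?_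
        congr 1
        simp only [Complex.real_smul]
        ring
      rw [heq] at e₁
      rw [← e₁.unique e₂, Finset.sum_insert hj]
      have : v - c j * (v / c j) = 0 := by field_simp; ring
      simp [this]
    obtain ⟨p, hp, hp'⟩ := key 1
    obtain ⟨q, hq, hq'⟩ := key Complex.I
    rw [Finset.card_insert_of_notMem hj]
    exact exists_mvPolynomial_of_fderiv (hG.differentiable (by simp)) hp hq hp' hq'

/-! ### Harmonicity from the mean value property -/

/-- A `C²` function with the mean value property for the polygons with vertices `z + c_k h`,
`|c_k| = 1`, is harmonic. -/
lemma harmonicOnNhd_of_sum_eq {ι : Type*} (s : Finset ι) (hs : s.Nonempty) (c : ι → ℂ)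
    (hc : ∀ k ∈ s, ‖c k‖ = 1) {G u : ℂ → ℂ} (hu : ContDiff ℝ 2 u)
    (h : ∀ z h, ∑ k ∈ s, u (z + c k * h) = G z) :
    InnerProductSpace.HarmonicOnNhd u Set.univ := by
  intro x _
  refine ⟨hu.contDiffAt, Filter.Eventually.of_forall fun z => ?_⟩
  -- Second derivative in `h` at `h = 0`; the sum is constant in `h`.
  have hsum : ∀ v : ℂ, ∑ k ∈ s, iteratedFDeriv ℝ 2 u z ![c k * v, c k * v] = 0 := by
    intro v
    have h1 : ∀ k, iteratedFDeriv ℝ 2 (fun h => u (z + c k * h)) 0 =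
        (iteratedFDeriv ℝ 2 u z).compContinuousLinearMap
          fun _ => ContinuousLinearMap.mul ℝ ℂ (c k) := by
      intro k
      have := (ContinuousLinearMap.mul ℝ ℂ (c k)).iteratedFDeriv_comp_right
        (f := fun y => u (z + y)) (hu.comp (contDiff_const.add contDiff_id)) 0 (i := 2) le_rfl
      rw [iteratedFDeriv_comp_add_left] at this
      simpa [Function.comp_def] using! this
    have h2 : iteratedFDeriv ℝ 2 (fun h => ∑ k ∈ s, u (z + c k * h)) 0 = 0 := by
      rw [funext (h z), iteratedFDeriv_const_of_ne two_ne_zero]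
      rfl
    rw [iteratedFDeriv_sum (f := fun k h => u (z + c k * h))
      (fun k _ => hu.comp (by fun_prop))] at h2
    simp only [Finset.sum_apply, h1] at h2
    have h3 := congrArg (fun M => M ![v, v]) h2
    simp only [sum_apply,
      ContinuousMultilinearMap.compContinuousLinearMap_apply,
      zero_apply] at h3
    rw [← h3]
    refine Finset.sum_congr rfl fun k _ => congrArg _ ?_
    ext i; fin_cases i <;> simp
  -- Since `|c k| = 1`, the vectors `c k` and `c k * I` form an orthonormal basis, and the trace of
  -- the Hessian does not depend on the basis.
  have hΔ : ∀ k ∈ s, iteratedFDeriv ℝ 2 u z ![c k * 1, c k * 1] +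
      iteratedFDeriv ℝ 2 u z ![c k * Complex.I, c k * Complex.I] = Laplacian.laplacian u z := by
    intro k hk
    rw [InnerProductSpace.laplacian_eq_iteratedFDeriv_complexPlane]
    simp only [iteratedFDeriv_two_apply, Matrix.cons_val_zero, Matrix.cons_val_one]
    set B := fderiv ℝ (fderiv ℝ u) z
    have hn : (c k).re * (c k).re + (c k).im * (c k).im = 1 := by
      rw [← Complex.normSq_apply, Complex.normSq_eq_norm_sq, hc k hk, one_pow]
    have e₁ : c k * 1 = (c k).re • (1 : ℂ) + (c k).im • Complex.I := by
      apply Complex.ext <;> simp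
    have e₂ : c k * Complex.I = (-(c k).im) • (1 : ℂ) + (c k).re • Complex.I := by
      apply Complex.ext <;> simp
    have hn' : ((c k).re : ℂ) * (c k).re + (c k).im * (c k).im = 1 := by exact_mod_cast hn
    rw [e₁, e₂]
    simp only [map_add, map_smul, add_apply, smul_apply]
    simp only [Complex.real_smul, Complex.ofReal_neg]
    linear_combination (B 1 1 + B Complex.I Complex.I) * hn'
  have h0 := (Finset.sum_congr rfl hΔ).symm
  rw [Finset.sum_add_distrib, hsum, hsum, add_zero, Finset.sum_const, nsmul_eq_mul] at h0
  have hcard : (s.card : ℂ) ≠ 0 := by exact_mod_cast hs.card_pos.ne'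
  simpa [hcard] using h0

/-! ### Interchange of a distribution and an integral -/

/-- Differentiation under the integral sign. The target `F` varies in the induction because the step
passes from `φ` to `fderiv ℝ φ`. -/
lemma iteratedFDeriv_integral_smul_sub {ψ : ℂ → ℝ} (hψ : ContDiff ℝ ∞ ψ)
    (hψc : HasCompactSupport ψ) (a : ℂ) (n : ℕ) :
    ∀ {F : Type} [NormedAddCommGroup F] [NormedSpace ℝ F] {φ : ℂ → F},
      ContDiff ℝ ∞ φ → HasCompactSupport φ → ∀ x : ℂ,
      iteratedFDeriv ℝ n (fun x => ∫ y, ψ y • φ (x - a * y)) x =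
        ∫ y, ψ y • iteratedFDeriv ℝ n φ (x - a * y) := by
  induction n with
  | zero =>
    intro F _ _ φ hφ hφc x
    simp only [iteratedFDeriv_zero_eq_comp, Function.comp_apply]
    refine (ContinuousLinearEquiv.integral_comp_comm (E := F)
      (X := ℂ) (μ := volume) (𝕜 := ℝ)
      (F := ContinuousMultilinearMap ℝ (fun _ : Fin 0 => ℂ) F)
      (continuousMultilinearCurryFin0 ℝ ℂ F).symm.toContinuousLinearEquiv _).symm.trans ?_
    simp
  | succ n ih =>
    intro F _ _ φ hφ hφc x
    have hd : ∀ x, HasFDerivAt (fun x => ∫ y, ψ y • φ (x - a * y))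
        (∫ y, ψ y • fderiv ℝ φ (x - a * y)) x := by
      intro x
      have hK : ∀ p : ℂ × ℂ, p ∉ tsupport φ ×ˢ tsupport ψ → ψ p.2 • φ p.1 = 0 := by
        intro p hp
        by_cases h1 : p.1 ∈ tsupport φ
        · have h2 : p.2 ∉ tsupport ψ := fun h2 => hp ⟨h1, h2⟩
          simp [image_eq_zero_of_notMem_tsupport h2]
        · simp [image_eq_zero_of_notMem_tsupport h1]
      have hΨ : ContDiff ℝ ∞ fun p : ℂ × ℂ => ψ p.2 • φ p.1 :=
        (hψ.comp contDiff_snd).smul (hφ.comp contDiff_fst)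
      have := hasFDerivAt_fiberIntegralFun (hφc.isCompact.prod hψc.isCompact) hΨ hK a x
      refine this.congr_fderiv (integral_congr_ae (ae_of_all _ fun y => ?_))
      have e : HasFDerivAt (fun z : ℂ => ψ y • φ z) (ψ y • fderiv ℝ φ (x - a * y)) (x - a * y) :=
        ((hφ.differentiable (by simp) _).hasFDerivAt).const_smul (ψ y)
      have e' := ((hΨ.differentiable (by simp)) (x - a * y, y)).hasFDerivAt.comp
        (f := fun z : ℂ => (z, y)) (x - a * y)
        ((hasFDerivAt_id (x - a * y)).prodMk (hasFDerivAt_const y (x - a * y)))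
      exact e'.unique e
    simp only [iteratedFDeriv_succ_eq_comp_right, Function.comp_apply]
    rw [show (fun x => fderiv ℝ (fun x => ∫ y, ψ y • φ (x - a * y)) x) =
      fun x => ∫ y, ψ y • fderiv ℝ φ (x - a * y) from funext fun x => (hd x).fderiv,
      ih (hφ.fderiv_right (by simp)) (hφc.fderiv ℝ)]
    refine (ContinuousLinearEquiv.integral_comp_comm
      (E := ContinuousMultilinearMap ℝ (fun _ : Fin n => ℂ) (ℂ →L[ℝ] F))
      (X := ℂ) (μ := volume) (𝕜 := ℝ)
      (F := ContinuousMultilinearMap ℝ (fun _ : Fin (n + 1) => ℂ) F)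
      (continuousMultilinearCurryRightEquiv' ℝ n ℂ F).symm.toContinuousLinearEquiv _).symm.trans ?_
    exact integral_congr_ae (ae_of_all _ fun y =>
      map_smul (continuousMultilinearCurryRightEquiv' ℝ n ℂ F).symm _ _)

/-- A linear functional dominated by `C ‖J ·‖`, for a linear map `J` into a normed space, is the
composition of `J` and a continuous linear functional. -/
lemma exists_clm_comp_eq {V E : Type*} [AddCommGroup V] [Module ℝ V] [NormedAddCommGroup E]
    [NormedSpace ℝ E] (J : V →ₗ[ℝ] E) (L : V →ₗ[ℝ] ℝ) (C : ℝ) (h : ∀ e, ‖L e‖ ≤ C * ‖J e‖) :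
    ∃ g : E →L[ℝ] ℝ, ∀ e, g (J e) = L e := by
  -- The bound forces `L` to vanish on `ker J`, so `L` factors through `J` algebraically. The factor
  -- is bounded by `C` on the range of `J`, and Hahn–Banach extends it.
  have hker : L ∈ (LinearMap.ker J).dualAnnihilator := by
    rw [Submodule.mem_dualAnnihilator]
    intro e he
    have := h e
    rw [LinearMap.mem_ker.1 he, norm_zero, mul_zero] at this
    exact norm_le_zero_iff.1 this
  obtain ⟨g₀, hg₀⟩ := (LinearMap.range_dualMap_eq_dualAnnihilator_ker J).ge hker
  have hg₀' : ∀ e, g₀ (J e) = L e := fun e => LinearMap.congr_fun hg₀ e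
  obtain ⟨g, hg, -⟩ := exists_extension_norm_eq (LinearMap.range J)
    ((g₀.domRestrict _).mkContinuous C (by
      rintro ⟨_, e, rfl⟩
      have := h e
      rwa [← hg₀' e] at this))
  exact ⟨g, fun e => (hg ⟨J e, e, rfl⟩).trans (hg₀' e)⟩

/-- Tuples of bounded continuous functions, to hold the derivatives of orders in `s` of a test
function. -/
def JetSpace (s : Finset ℕ) : Type :=
  (i : s) → BoundedContinuousFunction ℂ (ContinuousMultilinearMap ℝ (fun _ : Fin i => ℂ) ℝ)

namespace JetSpace

variable (s : Finset ℕ)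

noncomputable instance : NormedAddCommGroup (JetSpace s) :=
  inferInstanceAs (NormedAddCommGroup ((i : s) →
    BoundedContinuousFunction ℂ (ContinuousMultilinearMap ℝ (fun _ : Fin i => ℂ) ℝ)))

noncomputable instance : NormedSpace ℝ (JetSpace s) :=
  inferInstanceAs (NormedSpace ℝ ((i : s) →
    BoundedContinuousFunction ℂ (ContinuousMultilinearMap ℝ (fun _ : Fin i => ℂ) ℝ)))

instance : CompleteSpace (JetSpace s) :=
  inferInstanceAs (CompleteSpace ((i : s) →
    BoundedContinuousFunction ℂ (ContinuousMultilinearMap ℝ (fun _ : Fin i => ℂ) ℝ)))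

/-- The evaluation of the `i`-th entry at the point `x`. -/
noncomputable def evalCLM (i : s) (x : ℂ) :
    JetSpace s →L[ℝ] ContinuousMultilinearMap ℝ (fun _ : Fin i => ℂ) ℝ :=
  (BoundedContinuousFunction.evalCLM ℝ x).comp
    (ContinuousLinearMap.proj (R := ℝ) (φ := fun i : s =>
      BoundedContinuousFunction ℂ (ContinuousMultilinearMap ℝ (fun _ : Fin i => ℂ) ℝ)) i)

variable {s}

lemma ext_evalCLM {u v : JetSpace s} (h : ∀ i x, evalCLM s i x u = evalCLM s i x v) : u = v :=
  funext fun i => BoundedContinuousFunction.ext fun x => h i x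

/-- The derivatives of orders in `s` of a test function supported in `K`. -/
noncomputable def jet (s : Finset ℕ) (K : Compacts ℂ) :
    ContDiffMapSupportedIn ℂ ℝ ⊤ K →L[ℝ] JetSpace s :=
  ContinuousLinearMap.pi (φ := fun i : s =>
      BoundedContinuousFunction ℂ (ContinuousMultilinearMap ℝ (fun _ : Fin i => ℂ) ℝ))
    fun i => ContDiffMapSupportedIn.structureMapCLM ℝ ⊤ i

lemma evalCLM_jet {K : Compacts ℂ} (i : s) (x : ℂ) (e : ContDiffMapSupportedIn ℂ ℝ ⊤ K) :
    evalCLM s i x (jet s K e) = iteratedFDeriv ℝ i e x :=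
  congrFun (ContDiffMapSupportedIn.structureMapCLM_top_apply ℝ e) x

lemma seminorm_le_norm_jet {K : Compacts ℂ} (i : s) (e : ContDiffMapSupportedIn ℂ ℝ ⊤ K) :
    ContDiffMapSupportedIn.seminorm ℝ ℂ ℝ ⊤ K i e ≤ ‖jet s K e‖ :=
  norm_le_pi_norm (G := fun i : s =>
    BoundedContinuousFunction ℂ (ContinuousMultilinearMap ℝ (fun _ : Fin i => ℂ) ℝ))
    (jet s K e) i

end JetSpace

/-- A continuous linear functional on the test functions supported in `K` is given, through
finitely many derivatives, by a continuous linear functional on a Banach space; hence it commutes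
with integrals. -/
lemma clm_apply_eq_integral_real {K : Compacts ℂ}
    (L : ContDiffMapSupportedIn ℂ ℝ ⊤ K →L[ℝ] ℝ) {c : ℂ → ContDiffMapSupportedIn ℂ ℝ ⊤ K}
    (hc : Continuous c) (hcs : HasCompactSupport c) (d : ContDiffMapSupportedIn ℂ ℝ ⊤ K)
    (hd : ∀ (i : ℕ) (x : ℂ), iteratedFDeriv ℝ i d x = ∫ y, iteratedFDeriv ℝ i (c y) x) :
    L d = ∫ y, L (c y) := by
  obtain ⟨s, C, -, hC⟩ := Seminorm.bound_of_continuous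
    (ContDiffMapSupportedIn.withSeminorms ℝ ℂ ℝ ⊤ K) (normSeminorm ℝ ℝ |>.comp L.toLinearMap)
    (continuous_norm.comp L.continuous)
  have hbound : ∀ e, ‖L e‖ ≤ C * ‖JetSpace.jet s K e‖ := by
    intro e
    refine (hC e).trans ?_
    rw [smul_apply]
    refine mul_le_mul_of_nonneg_left ?_ C.2
    exact Seminorm.finset_sup_apply_le (norm_nonneg _) fun i hi =>
      JetSpace.seminorm_le_norm_jet ⟨i, hi⟩ e
  obtain ⟨g, hg⟩ := exists_clm_comp_eq (JetSpace.jet s K).toLinearMap L.toLinearMap C hbound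
  change ∀ e, g (JetSpace.jet s K e) = L e at hg
  have hint : Integrable fun y => JetSpace.jet s K (c y) :=
    ((JetSpace.jet s K).continuous.comp hc).integrable_of_hasCompactSupport
      (hcs.comp_left (map_zero _))
  -- A Bochner integral in the Banach space of jets; point evaluations separate jets and commute
  -- with it, which reduces the claim to `hd`.
  have hJd : JetSpace.jet s K d = ∫ y, JetSpace.jet s K (c y) := by
    refine JetSpace.ext_evalCLM fun i x => ?_
    rw [← ContinuousLinearMap.integral_comp_comm _ hint]
    simp only [JetSpace.evalCLM_jet]
    exact hd i x
  rw [← hg, hJd, ← g.integral_comp_comm hint]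
  simp only [hg]

/-- Real and imaginary parts reduce this to the real case. -/
lemma clm_apply_eq_integral {K : Compacts ℂ}
    (L : ContDiffMapSupportedIn ℂ ℝ ⊤ K →L[ℝ] ℂ) {c : ℂ → ContDiffMapSupportedIn ℂ ℝ ⊤ K}
    (hc : Continuous c) (hcs : HasCompactSupport c) (d : ContDiffMapSupportedIn ℂ ℝ ⊤ K)
    (hd : ∀ (i : ℕ) (x : ℂ), iteratedFDeriv ℝ i d x = ∫ y, iteratedFDeriv ℝ i (c y) x) :
    L d = ∫ y, L (c y) := by
  have hint : Integrable fun y => L (c y) :=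
    (L.continuous.comp hc).integrable_of_hasCompactSupport (hcs.comp_left (map_zero L))
  apply Complex.ext
  · have := clm_apply_eq_integral_real (Complex.reCLM.comp L) hc hcs d hd
    exact this.trans (Complex.reCLM.integral_comp_comm hint)
  · have := clm_apply_eq_integral_real (Complex.imCLM.comp L) hc hcs d hd
    exact this.trans (Complex.imCLM.integral_comp_comm hint)

lemma continuous_translate_boundedContinuousFunction {V : Type*} [NormedAddCommGroup V]
    (B : BoundedContinuousFunction ℂ V) (hB : UniformContinuous B) :
    Continuous fun v : ℂ => B.compContinuous ⟨fun x => x - v, by fun_prop⟩ := by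
  refine Metric.continuous_iff.2 fun v ε hε => ?_
  obtain ⟨δ, hδ, h⟩ := Metric.uniformContinuous_iff.1 hB (ε / 2) (half_pos hε)
  refine ⟨δ, hδ, fun v' hv' => ?_⟩
  refine lt_of_le_of_lt ((BoundedContinuousFunction.dist_le (half_pos hε).le).2 fun x => ?_)
    (half_lt_self hε)
  exact (h (by
    change dist (x - v') (x - v) < δ
    rwa [dist_sub_left])).le

/-! ### Translates, tensor products and convolutions of test functions -/

/-- The translate `x ↦ φ(x - v)` of a test function. -/
noncomputable def translate (φ : 𝓓((⊤ : Opens ℂ), ℝ)) (v : ℂ) : 𝓓((⊤ : Opens ℂ), ℝ) where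
  toFun x := φ (x - v)
  contDiff' := φ.contDiff.comp (contDiff_id.sub contDiff_const)
  hasCompactSupport' := φ.hasCompactSupport.comp_homeomorph (Homeomorph.subRight v)
  tsupport_subset' := fun _ _ => trivial

lemma translate_apply (φ : 𝓓((⊤ : Opens ℂ), ℝ)) (v x : ℂ) : translate φ v x = φ (x - v) := rfl

lemma translate_translate (φ : 𝓓((⊤ : Opens ℂ), ℝ)) (v v' : ℂ) :
    translate (translate φ v) v' = translate φ (v + v') := by
  ext x
  simp only [translate_apply]
  congr 1
  ring

lemma translate_zero (φ : 𝓓((⊤ : Opens ℂ), ℝ)) : translate φ 0 = φ := by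
  ext x
  simp [translate_apply]

/-- The tensor product `(x, y) ↦ φ(x) ψ(y)` of two test functions. -/
noncomputable def tensor (φ ψ : 𝓓((⊤ : Opens ℂ), ℝ)) : 𝓓((⊤ : Opens (ℂ × ℂ)), ℝ) where
  toFun p := ψ p.2 • φ p.1
  contDiff' := (ψ.contDiff.comp contDiff_snd).smul (φ.contDiff.comp contDiff_fst)
  hasCompactSupport' := HasCompactSupport.intro
    (φ.hasCompactSupport.isCompact.prod ψ.hasCompactSupport.isCompact) fun p hp => by
      by_cases h1 : p.1 ∈ tsupport φ
      · have h2 : p.2 ∉ tsupport ψ := fun h2 => hp ⟨h1, h2⟩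
        simp [image_eq_zero_of_notMem_tsupport h2]
      · simp [image_eq_zero_of_notMem_tsupport h1]
  tsupport_subset' := fun _ _ => trivial

lemma fiberIntegral_tensor_apply (φ ψ : 𝓓((⊤ : Opens ℂ), ℝ)) (a x : ℂ) :
    fiberIntegral a (tensor φ ψ) x = ∫ y, ψ y • φ (x - a * y) := rfl

/-- The sum `supp φ + a supp ψ` of the supports of two test functions. -/
noncomputable def sumSupport (φ ψ : 𝓓((⊤ : Opens ℂ), ℝ)) (a : ℂ) : Compacts ℂ :=
  sumCompacts a ⟨tsupport φ ×ˢ tsupport ψ,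
    φ.hasCompactSupport.isCompact.prod ψ.hasCompactSupport.isCompact⟩

lemma apply_eq_zero_of_notMem_sumSupport (φ ψ : 𝓓((⊤ : Opens ℂ), ℝ)) (a y : ℂ) {x : ℂ}
    (hx : x ∉ sumSupport φ ψ a) : ψ y • φ (x - a * y) = 0 := by
  by_cases h1 : x - a * y ∈ tsupport φ
  · have h2 : y ∉ tsupport ψ := fun h2 => hx ⟨(x - a * y, y), ⟨h1, h2⟩, by simp⟩
    simp [image_eq_zero_of_notMem_tsupport h2]
  · simp [image_eq_zero_of_notMem_tsupport h1]

/-- The test function `x ↦ ψ(y) φ(x - a y)`, supported in `supp φ + a supp ψ`. -/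
noncomputable def weightedTranslate (φ ψ : 𝓓((⊤ : Opens ℂ), ℝ)) (a y : ℂ) :
    ContDiffMapSupportedIn ℂ ℝ ⊤ (sumSupport φ ψ a) where
  toFun x := ψ y • φ (x - a * y)
  contDiff' := show ContDiff ℝ ∞ fun x => ψ y • φ (x - a * y) from
    ContDiff.smul (f := fun _ => ψ y) (g := fun x => φ (x - a * y)) contDiff_const
      (φ.contDiff.comp (contDiff_id.sub contDiff_const))
  zero_on_compl' := fun _ hx => apply_eq_zero_of_notMem_sumSupport φ ψ a y hx

lemma weightedTranslate_apply (φ ψ : 𝓓((⊤ : Opens ℂ), ℝ)) (a y x : ℂ) :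
    weightedTranslate φ ψ a y x = ψ y • φ (x - a * y) := rfl

lemma iteratedFDeriv_weightedTranslate (φ ψ : 𝓓((⊤ : Opens ℂ), ℝ)) (a y x : ℂ) (i : ℕ) :
    iteratedFDeriv ℝ i (weightedTranslate φ ψ a y) x =
      ψ y • iteratedFDeriv ℝ i φ (x - a * y) := by
  have h : ContDiff ℝ i fun x => φ (x - a * y) :=
    (φ.contDiff.comp (contDiff_id.sub contDiff_const)).of_le (by exact_mod_cast le_top)
  refine (iteratedFDeriv_const_smul_apply (a := ψ y) h.contDiffAt).trans ?_
  rw [iteratedFDeriv_comp_sub]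

/-- Each derivative of `φ` is continuous with compact support, hence uniformly continuous, so its
translates vary continuously in the sup norm. -/
lemma continuous_weightedTranslate (φ ψ : 𝓓((⊤ : Opens ℂ), ℝ)) (a : ℂ) :
    Continuous (weightedTranslate φ ψ a) := by
  rw [ContDiffMapSupportedIn.continuous_iff_comp]
  intro i
  have hcont : Continuous (iteratedFDeriv ℝ i φ) :=
    φ.contDiff.continuous_iteratedFDeriv (by exact_mod_cast le_top)
  have hsupp : HasCompactSupport (iteratedFDeriv ℝ i φ) := φ.hasCompactSupport.iteratedFDeriv i
  obtain ⟨C, hC⟩ := hcont.bounded_above_of_compact_support hsupp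
  let B := BoundedContinuousFunction.ofNormedAddCommGroup _ hcont C hC
  have hB := continuous_translate_boundedContinuousFunction B
    (hsupp.uniformContinuous_of_continuous hcont)
  have : Continuous fun y : ℂ => ψ y • B.compContinuous ⟨fun x => x - a * y, by fun_prop⟩ :=
    ψ.continuous.smul (hB.comp (continuous_const.mul continuous_id))
  refine this.congr fun y => ?_
  ext1 x
  exact (iteratedFDeriv_weightedTranslate φ ψ a y x i).symm.trans
    (congrFun (ContDiffMapSupportedIn.structureMapCLM_top_apply ℝ _) x).symm

lemma hasCompactSupport_weightedTranslate (φ ψ : 𝓓((⊤ : Opens ℂ), ℝ)) (a : ℂ) :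
    HasCompactSupport (weightedTranslate φ ψ a) :=
  HasCompactSupport.intro ψ.hasCompactSupport.isCompact fun y hy => by
    ext x
    simp [weightedTranslate_apply, image_eq_zero_of_notMem_tsupport hy]

/-- The restriction of a distribution to the test functions supported in a compact set. -/
noncomputable def restrictCLM (f : 𝓓'((⊤ : Opens ℂ), ℂ)) (K : Compacts ℂ) :
    ContDiffMapSupportedIn ℂ ℝ ⊤ K →L[ℝ] ℂ where
  toFun φ := f (TestFunction.ofSupportedIn (Set.subset_univ _) φ)
  map_add' φ ψ := map_add f (TestFunction.ofSupportedIn (Set.subset_univ _) φ)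
    (TestFunction.ofSupportedIn (Set.subset_univ _) ψ)
  map_smul' t φ := map_smul f t (TestFunction.ofSupportedIn (Set.subset_univ _) φ)
  cont := (map_continuous f).comp (TestFunction.continuous_ofSupportedIn _)

lemma restrictCLM_weightedTranslate (f : 𝓓'((⊤ : Opens ℂ), ℂ)) (φ ψ : 𝓓((⊤ : Opens ℂ), ℝ))
    (a y : ℂ) : restrictCLM f (sumSupport φ ψ a) (weightedTranslate φ ψ a y) =
      ψ y • f (translate φ (a * y)) :=
  map_smul f (ψ y) (translate φ (a * y))

/-- A distribution commutes with the convolution integral. -/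
lemma apply_fiberIntegral_tensor (f : 𝓓'((⊤ : Opens ℂ), ℂ)) (φ ψ : 𝓓((⊤ : Opens ℂ), ℝ))
    (a : ℂ) : f (fiberIntegral a (tensor φ ψ)) = ∫ y, ψ y • f (translate φ (a * y)) := by
  let d : ContDiffMapSupportedIn ℂ ℝ ⊤ (sumSupport φ ψ a) :=
    ⟨fiberIntegral a (tensor φ ψ), (fiberIntegral a (tensor φ ψ)).contDiff, fun x hx => by
      rw [fiberIntegral_tensor_apply]
      simp only [apply_eq_zero_of_notMem_sumSupport φ ψ a _ hx, integral_zero, Pi.zero_apply]⟩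
  have h := clm_apply_eq_integral (restrictCLM f _) (continuous_weightedTranslate φ ψ a)
    (hasCompactSupport_weightedTranslate φ ψ a) d fun i x => by
      simp only [iteratedFDeriv_weightedTranslate]
      exact iteratedFDeriv_integral_smul_sub ψ.contDiff ψ.hasCompactSupport a i φ.contDiff
        φ.hasCompactSupport x
  simp only [restrictCLM_weightedTranslate] at h
  exact h

/-- A smooth bump as a test function. -/
noncomputable def bumpTest {v : ℂ} (b : ContDiffBump v) : 𝓓((⊤ : Opens ℂ), ℝ) where
  toFun := b
  contDiff' := b.contDiff
  hasCompactSupport' := b.hasCompactSupport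
  tsupport_subset' := fun _ _ => trivial

lemma continuous_apply_translate (f : 𝓓'((⊤ : Opens ℂ), ℂ)) (φ : 𝓓((⊤ : Opens ℂ), ℝ)) :
    Continuous fun v => f (translate φ v) := by
  refine continuous_iff_continuousAt.2 fun v => ?_
  -- A bump equal to one near `v` keeps all supports in one compact set without changing the
  -- translates near `v`.
  let b : ContDiffBump v := default
  have h := (restrictCLM f _).continuous.comp (continuous_weightedTranslate φ (bumpTest b) 1)
  refine h.continuousAt.congr ?_
  filter_upwards [b.eventuallyEq_one] with y hy
  have hy' : bumpTest b y = 1 := hy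
  rw [Function.comp_apply, restrictCLM_weightedTranslate, hy', one_smul, one_mul]

lemma fiberIntegral_zero_tensor (φ ψ : 𝓓((⊤ : Opens ℂ), ℝ)) :
    fiberIntegral 0 (tensor φ ψ) = (∫ y, ψ y) • φ := by
  ext x
  rw [fiberIntegral_tensor_apply]
  simp only [zero_mul, sub_zero]
  exact integral_smul_const _ _

/-- Commutativity of convolution, by the substitution `y ↦ x - y`. -/
lemma fiberIntegral_one_tensor_comm (φ ψ : 𝓓((⊤ : Opens ℂ), ℝ)) :
    fiberIntegral 1 (tensor φ ψ) = fiberIntegral 1 (tensor ψ φ) := by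
  ext x
  rw [fiberIntegral_tensor_apply, fiberIntegral_tensor_apply,
    ← integral_sub_left_eq_self _ volume x]
  refine integral_congr_ae (ae_of_all _ fun y => ?_)
  simp [mul_comm]

/-! ### Radial test functions -/

lemma integral_comp_mul_of_norm_eq_one {E : Type*} [NormedAddCommGroup E] [NormedSpace ℝ E]
    (g : ℂ → E) {c : ℂ} (hc : ‖c‖ = 1) : ∫ y, g (c * y) = ∫ y, g y := by
  let e := rotation (⟨c, mem_sphere_zero_iff_norm.2 hc⟩ : Circle)
  exact e.measurePreserving.integral_comp e.toMeasurableEquiv.measurableEmbedding g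

/-- `ρ` is invariant under rotations. -/
def IsRadial (ρ : ℂ → ℝ) : Prop :=
  ∀ c y : ℂ, ‖c‖ = 1 → ρ (c * y) = ρ y

lemma fiberIntegral_tensor_of_isRadial (φ ρ : 𝓓((⊤ : Opens ℂ), ℝ)) (hρ : IsRadial ρ) {c : ℂ}
    (hc : ‖c‖ = 1) : fiberIntegral c (tensor φ ρ) = fiberIntegral 1 (tensor φ ρ) := by
  ext x
  rw [fiberIntegral_tensor_apply, fiberIntegral_tensor_apply,
    ← integral_comp_mul_of_norm_eq_one (fun y => ρ y • φ (x - 1 * y)) hc]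
  refine integral_congr_ae (ae_of_all _ fun y => ?_)
  simp [hρ c y hc]

lemma exists_isRadial : ∃ ρ : 𝓓((⊤ : Opens ℂ), ℝ), IsRadial ρ ∧ ∫ y, ρ y = 1 := by
  -- The squared norm is smooth at the origin, so composing it with a bump on the line gives a
  -- smooth radial function.
  let b : ContDiffBump (0 : ℝ) := default
  have hsmooth : ContDiff ℝ ∞ fun z : ℂ => b (‖z‖ ^ 2) := b.contDiff.comp (contDiff_norm_sq ℝ)
  have hsupp : HasCompactSupport fun z : ℂ => b (‖z‖ ^ 2) := by
    refine HasCompactSupport.intro (isCompact_closedBall (0 : ℂ) (b.rOut + 1)) fun z hz => ?_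
    refine b.zero_of_le_dist ?_
    rw [mem_closedBall_zero_iff, not_le] at hz
    have hpos := b.rOut_pos
    rw [dist_zero_right, Real.norm_of_nonneg (by positivity)]
    nlinarith
  have hpos : 0 < ∫ z : ℂ, b (‖z‖ ^ 2) :=
    hsmooth.continuous.integral_pos_of_hasCompactSupport_nonneg_nonzero (x := 0) hsupp
      (fun z => b.nonneg) (by
        have h : b (0 : ℝ) = 1 := b.one_of_mem_closedBall (Metric.mem_closedBall_self b.rIn_pos.le)
        simp [h])
  let r : 𝓓((⊤ : Opens ℂ), ℝ) := ⟨_, hsmooth, hsupp, fun _ _ => trivial⟩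
  refine ⟨(∫ z, r z)⁻¹ • r, fun c y hc => ?_, ?_⟩
  · change _ * b (‖c * y‖ ^ 2) = _ * b (‖y‖ ^ 2)
    rw [norm_mul, hc, one_mul]
  · exact (integral_const_mul _ _).trans (inv_mul_cancel₀ hpos.ne')

/-! ### Pointwise equation, representation by a function, and regularity -/

lemma vertexMean_apply (N : ℕ) (w : ℂ) (f : 𝓓'((⊤ : Opens ℂ), ℂ))
    (Φ : 𝓓((⊤ : Opens (ℂ × ℂ)), ℝ)) :
    vertexMean N w f Φ =
      (1 / (N : ℝ)) • ∑ k ∈ Finset.range N, f (fiberIntegral (w ^ k) Φ) := by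
  simp [vertexMean, shiftDistribution_apply]

/-- The pointwise form of the equations, for the functions `v ↦ f(φ(· - v))`. -/
lemma sum_apply_translate {N : ℕ} (hN : N ≠ 0) {w : ℂ} {f : 𝓓'((⊤ : Opens ℂ), ℂ)}
    {φ : 𝓓((⊤ : Opens ℂ), ℝ)} {a : ℂ}
    (h : ∀ ψ : 𝓓((⊤ : Opens ℂ), ℝ), vertexMean N w f (tensor φ ψ) = (∫ y, ψ y) • a) (v : ℂ) :
    ∑ k ∈ Finset.range N, f (translate φ (w ^ k * v)) = N * a := by
  have hcont : ∀ k, Continuous fun v => f (translate φ (w ^ k * v)) := fun k =>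
    (continuous_apply_translate f φ).comp (continuous_const.mul continuous_id)
  have hsum : Continuous fun v => ∑ k ∈ Finset.range N, f (translate φ (w ^ k * v)) :=
    continuous_finsetSum _ fun k _ => hcont k
  -- Both sides are continuous in `v` and have the same integral against every test function `ψ`, so
  -- they agree almost everywhere and then everywhere.
  have hae := ae_eq_of_integral_contDiff_smul_eq (μ := (volume : Measure ℂ))
    (f' := fun _ : ℂ => (N : ℂ) * a) hsum.locallyIntegrable continuous_const.locallyIntegrable (by
      intro g hg hgc
      let ψ : 𝓓((⊤ : Opens ℂ), ℝ) := ⟨g, hg, hgc, fun _ _ => trivial⟩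
      have hψ := h ψ
      rw [vertexMean_apply] at hψ
      simp only [apply_fiberIntegral_tensor] at hψ
      rw [← integral_finsetSum (f := fun k v => ψ v • f (translate φ (w ^ k * v))) _ fun k _ =>
        (ψ.continuous.smul (hcont k)).integrable_of_hasCompactSupport
          ψ.hasCompactSupport.smul_right] at hψ
      simp only [← Finset.smul_sum] at hψ
      have hN' : (N : ℝ) ≠ 0 := Nat.cast_ne_zero.2 hN
      rw [one_div, inv_smul_eq_iff₀ hN'] at hψ
      refine hψ.trans ?_
      rw [integral_smul_const]
      change _ = (∫ y, ψ y) • ((N : ℂ) * a)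
      rw [smul_comm]
      simp only [Complex.real_smul, Complex.ofReal_natCast])
  exact congrFun ((hsum.ae_eq_iff_eq volume continuous_const).1 hae) v

/-- A distribution that satisfies the Kakutani–Nagumo–Walsh equation is the function
`v ↦ f(ρ(· - v))`, for every radial test function `ρ` of integral one. -/
lemma apply_eq_integral_of_vertexMean_eq {N : ℕ} (hN : N ≠ 0) {w : ℂ} (hw : ‖w‖ = 1)
    {f : 𝓓'((⊤ : Opens ℂ), ℂ)} (hf : vertexMean N w f = tensorOne f)
    {ρ : 𝓓((⊤ : Opens ℂ), ℝ)} (hρ : IsRadial ρ) (hρ1 : ∫ y, ρ y = 1)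
    (φ : 𝓓((⊤ : Opens ℂ), ℝ)) : f φ = ∫ y, φ y • f (translate ρ y) := by
  have h : vertexMean N w f (tensor φ ρ) = tensorOne f (tensor φ ρ) := by rw [hf]
  -- Radiality replaces `w ^ k` by `1`; commuting the convolution then puts the translates on `ρ`
  -- and the weight on `φ`.
  have hk : ∀ k, f (fiberIntegral (w ^ k) (tensor φ ρ)) = ∫ y, φ y • f (translate ρ y) := by
    intro k
    rw [fiberIntegral_tensor_of_isRadial φ ρ hρ (by rw [norm_pow, hw, one_pow]),
      fiberIntegral_one_tensor_comm, apply_fiberIntegral_tensor]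
    simp only [one_mul]
  rw [vertexMean_apply, tensorOne, shiftDistribution_apply, fiberIntegral_zero_tensor, hρ1,
    one_smul] at h
  have hN' : (N : ℝ) ≠ 0 := Nat.cast_ne_zero.2 hN
  rw [← h, Finset.sum_congr rfl fun k _ => hk k, Finset.sum_const, Finset.card_range,
    ← Nat.cast_smul_eq_nsmul ℝ, smul_smul, one_div, inv_mul_cancel₀ hN', one_smul]

/-- The hypothesis says `u = u ∗ ρ`, because a radial `ρ` is even; convolution with a test function
is smooth. -/
lemma contDiff_of_eq_integral {ρ : 𝓓((⊤ : Opens ℂ), ℝ)} (hρ : IsRadial ρ) {u : ℂ → ℂ}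
    (hu : Continuous u) (h : ∀ v, u v = ∫ y, ρ (y - v) • u y) : ContDiff ℝ ∞ u := by
  have hconv : u = convolution u ρ (ContinuousLinearMap.lsmul ℝ ℝ).flip volume := by
    funext v
    rw [h v, convolution_def]
    refine integral_congr_ae (ae_of_all _ fun y => ?_)
    have := hρ (-1) (v - y) (by simp)
    rw [neg_one_mul, neg_sub] at this
    simp [this]
  rw [hconv]
  exact ρ.hasCompactSupport.contDiff_convolution_right (n := ⊤) _ hu.locallyIntegrable ρ.contDiff

lemma isHarmonicPolynomial_of_sum_eq {N : ℕ} (hN : N ≠ 0) {w : ℂ} (hw : ‖w‖ = 1) {u : ℂ → ℂ}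
    (hu : ContDiff ℝ ∞ u) (h : ∀ z v, ∑ k ∈ Finset.range N, u (z + w ^ k * v) = N * u z) :
    IsHarmonicPolynomial N u := by
  have hw0 : w ≠ 0 := fun h0 => by simp [h0] at hw
  have hN' : (N : ℂ) ≠ 0 := Nat.cast_ne_zero.2 hN
  constructor
  -- Every `g k` is `u / N`, so that the sum is `u` itself.
  · have := exists_mvPolynomial_of_sum_eq (Finset.range N) (fun k => w ^ k)
      (fun k _ => pow_ne_zero k hw0) u (fun _ z => (N : ℂ)⁻¹ * u z) hu
      (fun _ => contDiff_const.mul hu) fun z v => by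
        rw [← Finset.mul_sum, h, inv_mul_cancel_left₀ hN']
    rwa [Finset.card_range] at this
  · exact harmonicOnNhd_of_sum_eq (Finset.range N) (Finset.nonempty_range_iff.2 hN)
      (fun k => w ^ k) (fun k _ => by rw [norm_pow, hw, one_pow])
      (by exact_mod_cast contDiff_infty.1 hu 2) h

end KNW

theorem theorem8 (N : ℕ) (hN : 1 ≤ N) (w : ℂ) (hw : IsPrimitiveRoot w N)
    (f : 𝓓'((⊤ : Opens ℂ), ℂ))
    (hf : KNW.vertexMean N w f = KNW.tensorOne f ∨ KNW.vertexMean N w f = 0) :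
    ∃ u : ℂ → ℂ, KNW.IsHarmonicPolynomial N u ∧ KNW.EqFunction f u := by
  have hN0 : N ≠ 0 := by omega
  have hw1 : ‖w‖ = 1 := hw.norm'_eq_one hN0
  rcases hf with hf | hf
  · obtain ⟨ρ, hρ, hρ1⟩ := KNW.exists_isRadial
    have hrep := KNW.apply_eq_integral_of_vertexMean_eq hN0 hw1 hf hρ hρ1
    have hcont := KNW.continuous_apply_translate f ρ
    refine ⟨fun v => f (KNW.translate ρ v), KNW.isHarmonicPolynomial_of_sum_eq hN0 hw1
      (KNW.contDiff_of_eq_integral hρ hcont fun v => hrep (KNW.translate ρ v)) fun z v => ?_,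
      hcont, fun φ => ?_⟩
    -- The mean value property of `u` at `z` is the pointwise equation for the test function
    -- `translate ρ z`.
    · simp only [← KNW.translate_translate]
      refine KNW.sum_apply_translate hN0 (fun ψ => ?_) v
      rw [hf, KNW.tensorOne, KNW.shiftDistribution_apply, KNW.fiberIntegral_zero_tensor]
      exact map_smul f _ _
    · rw [hrep φ]
      simp only [Complex.real_smul]
  · have hf0 : ∀ φ, f φ = 0 := by
      intro φ
      -- At `v = 0` all `N` translates are `φ` itself.
      have h := KNW.sum_apply_translate hN0 (w := w) (f := f) (φ := φ) (a := 0)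
        (fun ψ => by rw [hf, smul_zero]; rfl) 0
      simpa [KNW.translate_zero, hN0] using h
    refine ⟨0, KNW.isHarmonicPolynomial_of_sum_eq hN0 hw1 contDiff_const (by simp),
      continuous_const, fun φ => by simp [hf0 φ]⟩
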